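/- Let $n\ge 1$ and let $B=M_n(\mathbb C)\oplus M_n(\mathbb C)\oplus M_n(\mathbb C)$. For a faithful state $\psi$ on $B$ let $m^*:B\to B\otimes B$ be the adjoint of the multiplication $m$ with respect to the inner products induced by $\psi\otimes\psi$ and $\psi$; for $\delta>0$, $\psi$ is a $\delta$-form if $mm^*=\delta^2\,\mathrm{id}_B$. There is exactly one tracial state $\psi$ on $B$ that is a $\delta$-form for some $\delta>0$. With this $\psi$ and $\delta$, the map \[A(x_1\oplus x_2\oplus x_3)=(x_1+x_2+x_3)\oplus(x_1+x_2)\oplus 0\] is completely positive and satisfies $m(A\otimes A)m^*=\delta^2A$, so $\mathcal G=(B,\psi,A)$ is a quantum graph. Put $\varepsilon_{\mathcal G}=\delta^{-2}(\mathrm{id}\otimes A)m^*(1)$ and let the quantum edge correspondence $E_{\mathcal G}=\mathrm{span}\{x\cdot\varepsilon_{\mathcal G}\cdot y: x,y\in B\}$ be the subcorrespondence of $B\otimes_\psi B$ it generates, where $a\cdot(x\otimes y)\cdot b=ax\otimes yb$ and $\langle x\otimes y\,|\,x'\otimes y'\rangle=y^*\psi(x^*x')y'$. For a C*-correspondence $X$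 over $B$ with universal covariant representation $(\pi,t)$ in the Cuntz--Pimsner algebra $\mathcal O_X$, a vector $\xi\in X^{\otimes m}$ is non-returning if $t^m(\xi)^*t^k(\eta)t^m(\xi)=0$ for all $0<k<m$ and $\eta\in X^{\otimes k}$, and $X$ satisfies Condition (S) if for every positive $x\in B$, every $k\in\mathbb N$ and every $\epsilon>0$ there are $m>k$ and a non-returning unit vector $\xi\in X^{\otimes m}$ with $\|x\|<\|\langle\xi\,|\,x\cdot\xi\rangle\|+\epsilon$. Then $E_{\mathcal G}$ satisfies Condition (S). Moreover, let $1_1,1_2,1_3$ be the central projections onto the three summands. For every $x\in B$ there are $a\ne b$ in $\{1,2,3\}$ such that for every $m\ge1$ the vector $(1_a\cdot\varepsilon_{\mathcal G}\cdot 1_b)\otimes(\varepsilon_{\mathcal G}\cdot 1_b)\otimes\cdots\otimes(\varepsilon_{\mathcal G}\cdot 1_b)\in E_{\mathcal G}^{\otimes m}$ has a positive multiple $\xi$ that is a non-returning unit vector with $\|\langle\xi\,|\,x\cdot\xi\rangle\|=\|x\|$. -/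

import Mathlib

open scoped Matrix.Norms.L2Operator MatrixOrder ComplexOrder TensorProduct ENNReal

noncomputable section

namespace QuantumGraphs

universe u

/-- A finite-dimensional C*-correspondence over a unital C*-algebra `B`: a right Hilbert
`B`-module `X`, with the inner product `⟨x | y⟩` conjugate-linear in `x` and linear in `y`, and a
left action of `B` by adjointable operators.  (Mathlib's `CStarModule` has
`⟨x | a • y⟩ = a * ⟨x | y⟩`, which is not the law `⟨x | y · b⟩ = ⟨x | y⟩ b` of a right module.)
A finite-dimensional inner product module is complete, so completeness is not a field. -/
structure Correspondence (B : Type u) [CStarAlgebra B] [PartialOrder B] [StarOrderedRing B] where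
  carrier : Type u
  [addCommGroup : AddCommGroup carrier]
  [module : Module ℂ carrier]
  [finiteDimensional : FiniteDimensional ℂ carrier]
  /-- the left action, `left b x = b · x` -/
  left : B →ₗ[ℂ] carrier →ₗ[ℂ] carrier
  /-- the right action, `right b x = x · b` -/
  right : B →ₗ[ℂ] carrier →ₗ[ℂ] carrier
  /-- the inner product, `inner x y = ⟨x | y⟩` -/
  inner : carrier →ₗ⋆[ℂ] carrier →ₗ[ℂ] B
  left_mul : ∀ b c x, left (b * c) x = left b (left c x)
  right_mul : ∀ b c x, right (b * c) x = right c (right b x)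
  right_one : ∀ x, right 1 x = x
  star_inner : ∀ x y, star (inner x y) = inner y x
  inner_right : ∀ b x y, inner x (right b y) = inner x y * b
  inner_left : ∀ b x y, inner (left b x) y = inner x (left (star b) y)
  inner_self_nonneg : ∀ x, 0 ≤ inner x x
  eq_zero_of_inner_self : ∀ x, inner x x = 0 → x = 0

attribute [instance] Correspondence.addCommGroup Correspondence.module
  Correspondence.finiteDimensional

section Positivity

variable {B : Type u} [CStarAlgebra B] [PartialOrder B] [StarOrderedRing B]

/-- A selfadjoint `M` is positive if `N* M N = -S* S` forces `S = 0`. -/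
theorem nonneg_of_forall {A : Type u} [CStarAlgebra A] [PartialOrder A] [StarOrderedRing A]
    (M : A) (hM : IsSelfAdjoint M) (h : ∀ N S : A, star N * (M * N) = -(star S * S) → S = 0) :
    0 ≤ M := by
  set N := M⁻ with hN
  have hNpos : 0 ≤ N := CFC.negPart_nonneg M
  have hNsa : star N = N := (IsSelfAdjoint.of_nonneg hNpos).star_eq
  have hMN : M * N = -(N * N) := by
    conv_lhs => rw [← CFC.posPart_sub_negPart M hM]
    rw [sub_mul, CFC.posPart_mul_negPart, zero_sub]
  obtain ⟨R, hR⟩ := CStarAlgebra.nonneg_iff_eq_star_mul_self.mp hNpos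
  have key : star N * (M * N) = -(star (R * N) * (R * N)) := by
    rw [hMN, hNsa, star_mul, hNsa, mul_neg, mul_assoc N (star R), ← mul_assoc (star R) R, ← hR]
  have hS : R * N = 0 := h N _ key
  have hNN : N * N = 0 := by
    nth_rewrite 1 [hR]
    rw [mul_assoc, hS, mul_zero]
  have hN0 : N = 0 := by
    rw [← CStarRing.star_mul_self_eq_zero_iff, hNsa, hNN]
  rw [← CFC.posPart_sub_negPart M hM, ← hN, hN0, sub_zero]
  exact CFC.posPart_nonneg M

theorem exists_eq_star_mul_self {A : Type u} [CStarAlgebra A] [PartialOrder A]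
    [StarOrderedRing A] (M : A) (hM : 0 ≤ M) : ∃ C, M = star C * C :=
  CStarAlgebra.nonneg_iff_eq_star_mul_self.mp hM

/-- If `v* M v ≥ 0` for all columns `v` then the matrix `M = M*` is positive. -/
theorem cstarMatrix_nonneg {k : ℕ} (M : CStarMatrix (Fin k) (Fin k) B) (hM : IsSelfAdjoint M)
    (h : ∀ v : Fin k → B, 0 ≤ ∑ i, ∑ j, star (v i) * M i j * v j) : 0 ≤ M := by
  refine nonneg_of_forall M hM fun N S key => ?_
  have hdiag : ∀ j, (∑ i, star (S i j) * S i j) = 0 := by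
    intro j
    apply le_antisymm
    · have h1 := h (fun i => N i j)
      have h2 : (∑ i, ∑ l, star (N i j) * M i l * N l j) = (star N * (M * N)) j j := by
        simp only [CStarMatrix.mul_apply, CStarMatrix.star_apply, Finset.mul_sum, mul_assoc]
      rw [h2, key] at h1
      have h3 : (-(star S * S)) j j = -(∑ i, star (S i j) * S i j) := by
        rw [CStarMatrix.neg_apply, CStarMatrix.mul_apply]
        rfl
      rw [h3] at h1
      exact neg_nonneg.mp h1
    · exact Finset.sum_nonneg fun i _ => star_mul_self_nonneg _
  apply CStarMatrix.ext
  intro i j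
  have := (Finset.sum_eq_zero_iff_of_nonneg
    (fun i _ => star_mul_self_nonneg (S i j))).mp (hdiag j) i (Finset.mem_univ i)
  exact CStarRing.star_mul_self_eq_zero_iff _ |>.mp this

/-- In a semi-inner product module, null vectors are orthogonal to every vector. -/
theorem form_eq_zero {V : Type u} [AddCommGroup V] [Module ℂ V] (F : V →ₗ⋆[ℂ] V →ₗ[ℂ] B)
    (R : B → V → V) (hR : ∀ b x y, F x (R b y) = F x y * b)
    (hs : ∀ x y, star (F x y) = F y x) (hp : ∀ x, 0 ≤ F x x) (z w : V) (hz : F z z = 0) :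
    F z w = 0 := by
  set b := F z w with hb
  have hR' : ∀ b x y, F (R b x) y = star b * F x y := fun b x y => by
    rw [← hs, hR, star_mul, hs]
  have hwz : F w z = star b := by rw [hb, hs]
  have h1 : ∀ t : ℝ, (2 * t) • (star b * b) ≤ F w w := fun t => by
    have := hp (w - (t : ℂ) • R b z)
    simp only [map_sub, LinearMap.sub_apply, map_smul, LinearMap.map_smulₛₗ, LinearMap.smul_apply,
      hR, hR', hz, hwz, ← hb, Complex.conj_ofReal, mul_zero, zero_mul, smul_zero, sub_zero] at this
    rw [← sub_nonneg]
    convert this using 1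
    simp only [Complex.coe_smul]
    rw [mul_smul, two_smul]
    abel
  have h2 : ∀ t : ℝ, 0 < t → 2 * t * ‖star b * b‖ ≤ ‖F w w‖ := fun t ht => by
    have := CStarAlgebra.norm_le_norm_of_nonneg_of_le
      (smul_nonneg (by positivity : 0 ≤ 2 * t) (star_mul_self_nonneg b)) (h1 t)
    rwa [norm_smul, Real.norm_of_nonneg (by positivity)] at this
  by_contra hne
  have hpos : 0 < ‖star b * b‖ := by
    rw [norm_pos_iff]
    exact fun h => hne (CStarRing.star_mul_self_eq_zero_iff _ |>.mp h)
  have := h2 ((‖F w w‖ + 1) / ‖star b * b‖) (by positivity)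
  rw [mul_assoc, div_mul_cancel₀ _ hpos.ne'] at this
  linarith [norm_nonneg (F w w)]

end Positivity

namespace Correspondence

variable {B : Type u} [CStarAlgebra B] [PartialOrder B] [StarOrderedRing B]

/-- `‖x‖ = ‖⟨x | x⟩‖^(1/2)`. -/
def norm (X : Correspondence B) (x : X.carrier) : ℝ := Real.sqrt ‖X.inner x x‖

theorem inner_left' (X : Correspondence B) (b : B) (x y : X.carrier) :
    X.inner x (X.left b y) = X.inner (X.left (star b) x) y := by
  rw [X.inner_left, star_star]

theorem inner_right_left (X : Correspondence B) (b : B) (x y : X.carrier) :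
    X.inner (X.right b x) y = star b * X.inner x y := by
  rw [← X.star_inner, X.inner_right, star_mul, X.star_inner]

theorem ext_inner (X : Correspondence B) {x y : X.carrier}
    (h : ∀ z, X.inner z x = X.inner z y) : x = y := by
  rw [← sub_eq_zero]
  apply X.eq_zero_of_inner_self
  rw [map_sub (X.inner (x - y)), h, sub_self]

theorem left_right (X : Correspondence B) (b c : B) (x : X.carrier) :
    X.left b (X.right c x) = X.right c (X.left b x) := by
  apply X.ext_inner
  intro z
  rw [X.inner_left', X.inner_right, X.inner_right, X.inner_left']

theorem gram_nonneg (X : Correspondence B) {k : ℕ} (x : Fin k → X.carrier) :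
    0 ≤ (CStarMatrix.ofMatrix (fun i j => X.inner (x i) (x j)) :
      CStarMatrix (Fin k) (Fin k) B) := by
  apply cstarMatrix_nonneg
  · apply CStarMatrix.ext
    intro i j
    exact X.star_inner (x j) (x i)
  · intro v
    have := X.inner_self_nonneg (∑ i, X.right (v i) (x i))
    simp only [map_sum, LinearMap.sum_apply, X.inner_right, X.inner_right_left] at this
    rw [Finset.sum_comm] at this
    exact this

section Tensor

variable (X Y : Correspondence B)

/-- The form `⟨x ⊗ y | x' ⊗ y'⟩ = ⟨y | ⟨x | x'⟩ · y'⟩` on the algebraic tensor product. -/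
def tensorForm : X.carrier ⊗[ℂ] Y.carrier →ₗ⋆[ℂ] X.carrier ⊗[ℂ] Y.carrier →ₗ[ℂ] B :=
  TensorProduct.lift <| LinearMap.mk₂'ₛₗ (starRingEnd ℂ) (starRingEnd ℂ)
    (fun x y => TensorProduct.lift <| LinearMap.mk₂ ℂ
      (fun x' y' => Y.inner y (Y.left (X.inner x x') y'))
      (by intros; simp) (by intros; simp) (by intros; simp) (by intros; simp))
    (by intros; ext; simp) (by intros; ext; simp) (by intros; ext; simp) (by intros; ext; simp)

@[simp] theorem tensorForm_tmul (x x' : X.carrier) (y y' : Y.carrier) :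
    tensorForm X Y (x ⊗ₜ y) (x' ⊗ₜ y') = Y.inner y (Y.left (X.inner x x') y') := rfl

theorem star_tensorForm (z w : X.carrier ⊗[ℂ] Y.carrier) :
    star (tensorForm X Y z w) = tensorForm X Y w z := by
  induction z with
  | zero => simp
  | add z z' hz hz' => simp [hz, hz']
  | tmul x y =>
    induction w with
    | zero => simp
    | add w w' hw hw' => simp [hw, hw']
    | tmul x' y' =>
      rw [tensorForm_tmul, tensorForm_tmul, Y.star_inner, Y.inner_left, X.star_inner]

theorem tensorForm_nonneg (z : X.carrier ⊗[ℂ] Y.carrier) : 0 ≤ tensorForm X Y z z := by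
  obtain ⟨S, hS⟩ := TensorProduct.exists_finset z
  let e := S.equivFin
  set k := S.card
  let x : Fin k → X.carrier := fun i => (e.symm i).1.1
  let y : Fin k → Y.carrier := fun i => (e.symm i).1.2
  have hz : z = ∑ i, x i ⊗ₜ[ℂ] y i := by
    rw [hS, ← Finset.sum_coe_sort S]
    exact (Equiv.sum_comp e.symm (fun p : S => p.1.1 ⊗ₜ[ℂ] p.1.2)).symm
  obtain ⟨C, hC⟩ := exists_eq_star_mul_self _ (X.gram_nonneg x)
  have hC' : ∀ i j, X.inner (x i) (x j) = ∑ l, star (C l i) * C l j := fun i j => by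
    have := congrArg (fun M : CStarMatrix (Fin k) (Fin k) B => M i j) hC
    simp only [CStarMatrix.mul_apply, CStarMatrix.star_apply] at this
    exact this
  have : tensorForm X Y z z
      = ∑ l, Y.inner (∑ i, Y.left (C l i) (y i)) (∑ i, Y.left (C l i) (y i)) := by
    rw [hz]
    simp only [map_sum, LinearMap.sum_apply, tensorForm_tmul, hC', Y.inner_left, Y.left_mul]
    rw [Finset.sum_comm, Finset.sum_comm' (t' := Finset.univ) (s' := fun _ => Finset.univ)
      (by simp)]
    rw [eq_comm, Finset.sum_comm]
    refine Finset.sum_congr rfl fun i _ => ?_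
    rw [Finset.sum_comm]
  rw [this]
  exact Finset.sum_nonneg fun l _ => Y.inner_self_nonneg _

theorem tensorForm_right (b : B) (z w : X.carrier ⊗[ℂ] Y.carrier) :
    tensorForm X Y z ((Y.right b).lTensor X.carrier w) = tensorForm X Y z w * b := by
  induction z with
  | zero => simp
  | add z z' hz hz' => simp [hz, hz', add_mul]
  | tmul x y =>
    induction w with
    | zero => simp
    | add w w' hw hw' => simp only [map_add, hw, hw', add_mul]
    | tmul x' y' =>
      rw [LinearMap.lTensor_tmul, tensorForm_tmul, tensorForm_tmul, Y.left_right, Y.inner_right]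

theorem tensorForm_left (b : B) (z w : X.carrier ⊗[ℂ] Y.carrier) :
    tensorForm X Y ((X.left b).rTensor Y.carrier z) w
      = tensorForm X Y z ((X.left (star b)).rTensor Y.carrier w) := by
  induction z with
  | zero => simp
  | add z z' hz hz' => simp [hz, hz']
  | tmul x y =>
    induction w with
    | zero => simp
    | add w w' hw hw' => simp only [map_add, hw, hw']
    | tmul x' y' => simp [X.inner_left]

/-- The null space of the form (by Cauchy-Schwarz, the set of all `z` with `⟨z | z⟩ = 0`). -/
def tensorNull : Submodule ℂ (X.carrier ⊗[ℂ] Y.carrier) := LinearMap.ker (tensorForm X Y)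

theorem mem_tensorNull {z : X.carrier ⊗[ℂ] Y.carrier} :
    z ∈ tensorNull X Y ↔ ∀ w, tensorForm X Y z w = 0 := by
  rw [tensorNull, LinearMap.mem_ker, LinearMap.ext_iff]; rfl

theorem mem_tensorNull' {z : X.carrier ⊗[ℂ] Y.carrier} :
    z ∈ tensorNull X Y ↔ ∀ w, tensorForm X Y w z = 0 := by
  rw [mem_tensorNull]
  exact forall_congr' fun w => by rw [← star_tensorForm, star_eq_zero]

theorem mem_tensorNull_iff_self {z : X.carrier ⊗[ℂ] Y.carrier} :
    z ∈ tensorNull X Y ↔ tensorForm X Y z z = 0 := by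
  rw [mem_tensorNull]
  exact ⟨fun h => h z, fun h w => form_eq_zero (tensorForm X Y)
    (fun b => (Y.right b).lTensor X.carrier) (tensorForm_right X Y) (star_tensorForm X Y)
    (tensorForm_nonneg X Y) z w h⟩

/-- The underlying space of `X ⊗_B Y`: the quotient by null vectors.  It is finite-dimensional,
hence complete. -/
abbrev TensorCarrier : Type u := (X.carrier ⊗[ℂ] Y.carrier) ⧸ tensorNull X Y

theorem tensorNull_left (b : B) :
    tensorNull X Y ≤ (tensorNull X Y).comap ((X.left b).rTensor Y.carrier) := fun z hz => by
  rw [Submodule.mem_comap, mem_tensorNull]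
  intro w
  rw [tensorForm_left]
  exact (mem_tensorNull X Y).mp hz _

theorem tensorNull_right (b : B) :
    tensorNull X Y ≤ (tensorNull X Y).comap ((Y.right b).lTensor X.carrier) := fun z hz => by
  rw [Submodule.mem_comap, mem_tensorNull']
  intro w
  rw [tensorForm_right, (mem_tensorNull' X Y).mp hz, zero_mul]

def tensorLeft : B →ₗ[ℂ] TensorCarrier X Y →ₗ[ℂ] TensorCarrier X Y where
  toFun b := Submodule.mapQ _ _ ((X.left b).rTensor Y.carrier) (tensorNull_left X Y b)
  map_add' b c := by
    apply Submodule.linearMap_qext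
    ext; simp
  map_smul' a b := by
    apply Submodule.linearMap_qext
    ext; simp

def tensorRight : B →ₗ[ℂ] TensorCarrier X Y →ₗ[ℂ] TensorCarrier X Y where
  toFun b := Submodule.mapQ _ _ ((Y.right b).lTensor X.carrier) (tensorNull_right X Y b)
  map_add' b c := by
    apply Submodule.linearMap_qext
    ext; simp
  map_smul' a b := by
    apply Submodule.linearMap_qext
    ext; simp

def tensorInner : TensorCarrier X Y →ₗ⋆[ℂ] TensorCarrier X Y →ₗ[ℂ] B :=
  (tensorNull X Y).liftQ
    { toFun := fun z => (tensorNull X Y).liftQ (tensorForm X Y z)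
        fun _ hw => (mem_tensorNull' X Y).mp hw z
      map_add' := fun _ _ => by
        apply Submodule.linearMap_qext
        ext; simp; rfl
      map_smul' := fun _ _ => by
        apply Submodule.linearMap_qext
        ext; simp; rfl }
    fun z hz => by
      rw [LinearMap.mem_ker]
      apply Submodule.linearMap_qext
      ext w w'
      exact (mem_tensorNull X Y).mp hz _

theorem tensorInner_mk (z w : X.carrier ⊗[ℂ] Y.carrier) :
    tensorInner X Y (Submodule.Quotient.mk z) (Submodule.Quotient.mk w) = tensorForm X Y z w := rfl

/-- The internal tensor product `X ⊗_B Y`. -/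
def tensor : Correspondence B where
  carrier := TensorCarrier X Y
  left := tensorLeft X Y
  right := tensorRight X Y
  inner := tensorInner X Y
  left_mul b c z := by
    obtain ⟨z, rfl⟩ := Submodule.Quotient.mk_surjective _ z
    refine congrArg Submodule.Quotient.mk ?_
    induction z with
    | zero => simp
    | add z w hz hw => simp only [map_add, hz, hw]
    | tmul x y => simp [X.left_mul]
  right_mul b c z := by
    obtain ⟨z, rfl⟩ := Submodule.Quotient.mk_surjective _ z
    refine congrArg Submodule.Quotient.mk ?_
    induction z with
    | zero => simp
    | add z w hz hw => simp only [map_add, hz, hw]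
    | tmul x y => simp [Y.right_mul]
  right_one z := by
    obtain ⟨z, rfl⟩ := Submodule.Quotient.mk_surjective _ z
    refine congrArg Submodule.Quotient.mk ?_
    induction z with
    | zero => simp
    | add z w hz hw => simp only [map_add, hz, hw]
    | tmul x y => simp [Y.right_one]
  star_inner z w := by
    obtain ⟨z, rfl⟩ := Submodule.Quotient.mk_surjective _ z
    obtain ⟨w, rfl⟩ := Submodule.Quotient.mk_surjective _ w
    exact star_tensorForm X Y z w
  inner_right b z w := by
    obtain ⟨z, rfl⟩ := Submodule.Quotient.mk_surjective _ z
    obtain ⟨w, rfl⟩ := Submodule.Quotient.mk_surjective _ w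
    exact tensorForm_right X Y b z w
  inner_left b z w := by
    obtain ⟨z, rfl⟩ := Submodule.Quotient.mk_surjective _ z
    obtain ⟨w, rfl⟩ := Submodule.Quotient.mk_surjective _ w
    exact tensorForm_left X Y b z w
  inner_self_nonneg z := by
    obtain ⟨z, rfl⟩ := Submodule.Quotient.mk_surjective _ z
    exact tensorForm_nonneg X Y z
  eq_zero_of_inner_self z h := by
    obtain ⟨z, rfl⟩ := Submodule.Quotient.mk_surjective _ z
    rw [Submodule.Quotient.mk_eq_zero]
    exact (mem_tensorNull_iff_self X Y).mpr h

/-- The elementary tensor `x ⊗ y` in `X ⊗_B Y`. -/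
def tprod {X Y : Correspondence B} (x : X.carrier) (y : Y.carrier) : (tensor X Y).carrier :=
  (Submodule.Quotient.mk (x ⊗ₜ[ℂ] y) : TensorCarrier X Y)

end Tensor

/-- `B` as a correspondence over itself, with `⟨x | y⟩ = x* y`. -/
def self (B : Type u) [CStarAlgebra B] [PartialOrder B] [StarOrderedRing B]
    [FiniteDimensional ℂ B] : Correspondence B where
  carrier := B
  left := LinearMap.mul ℂ B
  right := (LinearMap.mul ℂ B).flip
  inner := LinearMap.mk₂'ₛₗ (starRingEnd ℂ) (RingHom.id ℂ) (fun x y => star x * y)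
    (by intros; simp [add_mul]) (by intros; simp) (by intros; simp [mul_add])
    (by intros; simp)
  left_mul b c x := by simp [mul_assoc]
  right_mul b c x := by simp [mul_assoc]
  right_one x := by simp
  star_inner x y := by simp
  inner_right b x y := by simp [mul_assoc]
  inner_left b x y := by simp [mul_assoc]
  inner_self_nonneg x := star_mul_self_nonneg x
  eq_zero_of_inner_self x h := CStarRing.star_mul_self_eq_zero_iff _ |>.mp h

/-- The subcorrespondence on a subspace that is invariant under both actions. -/
def sub (X : Correspondence B) (V : Submodule ℂ X.carrier)
    (hl : ∀ b, ∀ x ∈ V, X.left b x ∈ V) (hr : ∀ b, ∀ x ∈ V, X.right b x ∈ V) :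
    Correspondence B where
  carrier := V
  left :=
    { toFun := fun b => (X.left b).restrict (hl b)
      map_add' := fun _ _ => by ext; simp
      map_smul' := fun _ _ => by ext; simp }
  right :=
    { toFun := fun b => (X.right b).restrict (hr b)
      map_add' := fun _ _ => by ext; simp
      map_smul' := fun _ _ => by ext; simp }
  inner := LinearMap.mk₂'ₛₗ (starRingEnd ℂ) (RingHom.id ℂ)
    (fun x y => X.inner (x : X.carrier) (y : X.carrier))
    (by intros; simp) (by intros; simp) (by intros; simp) (by intros; simp)
  left_mul b c x := Subtype.ext (X.left_mul b c x)
  right_mul b c x := Subtype.ext (X.right_mul b c x)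
  right_one x := Subtype.ext (X.right_one x)
  star_inner x y := X.star_inner x y
  inner_right b x y := X.inner_right b x y
  inner_left b x y := X.inner_left b x y
  inner_self_nonneg x := X.inner_self_nonneg x
  eq_zero_of_inner_self x h := Subtype.ext (X.eq_zero_of_inner_self x h)

/-- The tensor powers `X^{⊗m}` over `B`: `X^{⊗0} = B`, `X^{⊗1} = X`,
`X^{⊗(m+2)} = X ⊗_B X^{⊗(m+1)}`. -/
def tpow [FiniteDimensional ℂ B] (X : Correspondence B) : ℕ → Correspondence B
  | 0 => self B
  | 1 => X
  | m + 2 => tensor X (tpow X (m + 1))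

/-- The vector `ξ ⊗ η ⊗ ⋯ ⊗ η` of `X^{⊗(k+1)}`. -/
def powTensor [FiniteDimensional ℂ B] (X : Correspondence B) (ξ η : X.carrier) :
    (k : ℕ) → (X.tpow (k + 1)).carrier
  | 0 => ξ
  | k + 1 => tprod ξ (powTensor X η η k)

/-- The operator `θ_{ξ,η}(μ) = ξ · ⟨η | μ⟩`. -/
def rankOne (X : Correspondence B) (ξ η : X.carrier) : X.carrier →ₗ[ℂ] X.carrier :=
  X.right.flip ξ ∘ₗ X.inner η

/-- `K(X)`, the span of the rank-one operators (closed, since `X` is finite-dimensional). -/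
def compacts (X : Correspondence B) : Submodule ℂ (X.carrier →ₗ[ℂ] X.carrier) :=
  Submodule.span ℂ {T | ∃ ξ η, T = X.rankOne ξ η}

/-- The Katsura ideal `J_X = φ⁻¹(K(X)) ∩ (ker φ)^⊥`, for the left action `φ`. -/
def katsuraIdeal (X : Correspondence B) : Set B :=
  {y | X.left y ∈ X.compacts ∧ ∀ x, X.left x = 0 → x * y = 0}

/-- Toeplitz representations `(π, t)` of `X` in a C*-algebra `D`. -/
structure IsToeplitz (X : Correspondence B) {D : Type*} [NonUnitalCStarAlgebra D]
    (π : B →⋆ₙₐ[ℂ] D) (t : X.carrier →ₗ[ℂ] D) : Prop where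
  left : ∀ b ξ, π b * t ξ = t (X.left b ξ)
  inner : ∀ ξ η, star (t ξ) * t η = π (X.inner ξ η)

/-- Covariant representations: `π(b) = ψ_t(φ(b))` for `b ∈ J_X`, where `ψ_t : K(X) → D` is the
linear map determined by `ψ_t(θ_{ξ,η}) = t(ξ) t(η)*`; an element of `K(X)` is a finite sum of
operators `θ_{ξ,η}`. -/
structure IsCovariant (X : Correspondence B) {D : Type*} [NonUnitalCStarAlgebra D]
    (π : B →⋆ₙₐ[ℂ] D) (t : X.carrier →ₗ[ℂ] D) : Prop extends X.IsToeplitz π t where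
  covariant : ∀ b ∈ X.katsuraIdeal, ∀ (k : ℕ) (ξ η : Fin k → X.carrier),
    X.left b = ∑ i, X.rankOne (ξ i) (η i) → π b = ∑ i, t (ξ i) * star (t (η i))

/-- The tensor product `x ⊗ y ↦ t(x) s(y)` of Toeplitz representations `(π, t)` of `X` and
`(π, s)` of `Y`. -/
def toeplitzTensor {X Y : Correspondence B} {D : Type*} [NonUnitalCStarAlgebra D]
    {π : B →⋆ₙₐ[ℂ] D} (t : {t : X.carrier →ₗ[ℂ] D // X.IsToeplitz π t})
    (s : {s : Y.carrier →ₗ[ℂ] D // Y.IsToeplitz π s}) :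
    {r : (tensor X Y).carrier →ₗ[ℂ] D // (tensor X Y).IsToeplitz π r} := by
  let r₀ : X.carrier ⊗[ℂ] Y.carrier →ₗ[ℂ] D :=
    TensorProduct.lift ((LinearMap.mul ℂ D).compl₁₂ t.1 s.1)
  have h₀ : ∀ z w, star (r₀ z) * r₀ w = π (tensorForm X Y z w) := by
    intro z w
    induction z with
    | zero => simp
    | add z z' hz hz' => simp [hz, hz', add_mul]
    | tmul x y =>
      induction w with
      | zero => simp
      | add w w' hw hw' => simp only [map_add, hw, hw', mul_add]
      | tmul x' y' =>
        rw [tensorForm_tmul, ← s.2.inner, ← s.2.left, ← t.2.inner]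
        simp [r₀, mul_assoc]
  refine ⟨(tensorNull X Y).liftQ r₀ fun z hz => ?_, ⟨fun b z => ?_, fun z w => ?_⟩⟩
  · rw [LinearMap.mem_ker, ← CStarRing.star_mul_self_eq_zero_iff, h₀,
      (mem_tensorNull X Y).mp hz, map_zero]
  · obtain ⟨z, rfl⟩ := Submodule.Quotient.mk_surjective _ z
    change π b * r₀ z = r₀ ((X.left b).rTensor Y.carrier z)
    induction z with
    | zero => simp
    | add z z' hz hz' => simp only [map_add, mul_add, hz, hz']
    | tmul x y => simp [r₀, ← t.2.left, mul_assoc]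
  · obtain ⟨z, rfl⟩ := Submodule.Quotient.mk_surjective _ z
    obtain ⟨w, rfl⟩ := Submodule.Quotient.mk_surjective _ w
    exact h₀ z w

theorem toeplitzTensor_tprod {X Y : Correspondence B} {D : Type*} [NonUnitalCStarAlgebra D]
    {π : B →⋆ₙₐ[ℂ] D} (t : {t : X.carrier →ₗ[ℂ] D // X.IsToeplitz π t})
    (s : {s : Y.carrier →ₗ[ℂ] D // Y.IsToeplitz π s}) (x : X.carrier) (y : Y.carrier) :
    (toeplitzTensor t s).1 (tprod x y) = t.1 x * s.1 y := rfl

/-- The maps `t^m : X^{⊗m} → D`, with `t^0 = π`, `t^1 = t` and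
`t^(m+2)(ξ ⊗ η) = t(ξ) t^(m+1)(η)`. -/
def toeplitzPow [FiniteDimensional ℂ B] (X : Correspondence B) {D : Type*}
    [NonUnitalCStarAlgebra D] {π : B →⋆ₙₐ[ℂ] D}
    (t : {t : X.carrier →ₗ[ℂ] D // X.IsToeplitz π t}) :
    (m : ℕ) → {r : (X.tpow m).carrier →ₗ[ℂ] D // (X.tpow m).IsToeplitz π r}
  | 0 => ⟨{ toFun := π, map_add' := map_add π, map_smul' := map_smul π },
      ⟨fun b (x : B) => (map_mul π b x).symm, fun (x y : B) => by
        change star (π x) * π y = π (star x * y)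
        rw [map_mul, map_star]⟩⟩
  | 1 => t
  | m + 2 => toeplitzTensor t (toeplitzPow X t (m + 1))

section CuntzPimsner

variable (X : Correspondence B)

/-- A covariant representation of `X` in some C*-algebra. -/
structure CovariantRep where
  D : Type u
  [cstar : NonUnitalCStarAlgebra D]
  π : B →⋆ₙₐ[ℂ] D
  t : X.carrier →ₗ[ℂ] D
  isCovariant : X.IsCovariant π t

attribute [instance] CovariantRep.cstar

/-- The `ℓ^∞`-product of the C*-algebras of all covariant representations. -/
abbrev RepProduct : Type (u + 1) := lp (fun R : CovariantRep X => R.D) ∞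

def prodπ : B →⋆ₙₐ[ℂ] RepProduct X where
  toFun b := ⟨fun R => R.π b, memℓp_infty ⟨‖b‖, by
    rintro _ ⟨R, rfl⟩
    exact NonUnitalStarAlgHom.norm_apply_le R.π b⟩⟩
  map_smul' a b := by ext R; exact map_smul R.π a b
  map_zero' := by ext R; exact map_zero R.π
  map_add' a b := by ext R; exact map_add R.π a b
  map_mul' a b := by ext R; exact map_mul R.π a b
  map_star' a := by ext R; exact map_star R.π a

def prodt : X.carrier →ₗ[ℂ] RepProduct X where
  toFun x := ⟨fun R => R.t x, memℓp_infty ⟨X.norm x, by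
    rintro _ ⟨R, rfl⟩
    refine Real.le_sqrt_of_sq_le ?_
    rw [sq, ← CStarRing.norm_star_mul_self, R.isCovariant.inner]
    exact NonUnitalStarAlgHom.norm_apply_le R.π _⟩⟩
  map_add' a b := by ext R; exact map_add R.t a b
  map_smul' a b := by ext R; exact map_smul R.t a b

def cuntzPimsnerSubalgebra : NonUnitalStarSubalgebra ℂ (RepProduct X) :=
  (NonUnitalStarAlgebra.adjoin ℂ
    (Set.range (prodπ X) ∪ Set.range (prodt X))).topologicalClosure

/-- The Cuntz-Pimsner algebra `O_X`: the C*-algebra generated by the universal covariant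
representation, which is the product of all covariant representations of `X`.  Restricting these
to one universe loses nothing: `B` and `X` are finite-dimensional in every use, so a covariant
representation generates a separable C*-algebra, which has a copy in every universe. -/
def CuntzPimsner : Type (u + 1) := cuntzPimsnerSubalgebra X

instance : NonUnitalCStarAlgebra (CuntzPimsner X) :=
  NonUnitalStarSubalgebra.nonUnitalCStarAlgebra (cuntzPimsnerSubalgebra X)
    (h_closed := NonUnitalStarSubalgebra.isClosed_topologicalClosure _)

theorem prodπ_mem (b : B) : prodπ X b ∈ cuntzPimsnerSubalgebra X :=
  NonUnitalStarSubalgebra.le_topologicalClosure _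
    (NonUnitalStarAlgebra.subset_adjoin ℂ _ (Or.inl ⟨b, rfl⟩))

theorem prodt_mem (x : X.carrier) : prodt X x ∈ cuntzPimsnerSubalgebra X :=
  NonUnitalStarSubalgebra.le_topologicalClosure _
    (NonUnitalStarAlgebra.subset_adjoin ℂ _ (Or.inr ⟨x, rfl⟩))

/-- The universal `π_X : B → O_X`. -/
def univπ : B →⋆ₙₐ[ℂ] CuntzPimsner X :=
  NonUnitalStarAlgHom.codRestrict (prodπ X) (cuntzPimsnerSubalgebra X) (prodπ_mem X)

/-- The universal `t_X : X → O_X`. -/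
def univt : X.carrier →ₗ[ℂ] CuntzPimsner X :=
  LinearMap.codRestrict (cuntzPimsnerSubalgebra X).toSubmodule (prodt X) (prodt_mem X)

/-- Evaluation of `O_X` at a covariant representation. -/
def evalRep (R : CovariantRep X) : CuntzPimsner X →⋆ₙₐ[ℂ] R.D where
  toFun a := a.1 R
  map_smul' _ _ := rfl
  map_zero' := rfl
  map_add' _ _ := rfl
  map_mul' _ _ := rfl
  map_star' _ := rfl

theorem cuntzPimsner_ext {a b : CuntzPimsner X} (h : ∀ R, evalRep X R a = evalRep X R b) :
    a = b :=
  Subtype.ext (lp.ext (funext h))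

theorem univ_isCovariant : X.IsCovariant (univπ X) (univt X) where
  left b ξ := cuntzPimsner_ext X fun R => by
    rw [map_mul]; exact R.isCovariant.left b ξ
  inner ξ η := cuntzPimsner_ext X fun R => by
    rw [map_mul, map_star]; exact R.isCovariant.inner ξ η
  covariant b hb k ξ η h := cuntzPimsner_ext X fun R => by
    rw [map_sum]
    simp only [map_mul, map_star]
    exact R.isCovariant.covariant b hb k ξ η h

/-- The universal property of `(O_X, π_X, t_X)`. -/
theorem univ_universal (R : CovariantRep X) : ∃ ρ : CuntzPimsner X →⋆ₙₐ[ℂ] R.D,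
    (∀ b, ρ (univπ X b) = R.π b) ∧ ∀ x, ρ (univt X x) = R.t x :=
  ⟨evalRep X R, fun _ => rfl, fun _ => rfl⟩

variable [FiniteDimensional ℂ B]

/-- The maps `t_X^m : X^{⊗m} → O_X`. -/
def univtPow (m : ℕ) : (X.tpow m).carrier →ₗ[ℂ] CuntzPimsner X :=
  (X.toeplitzPow ⟨univt X, (univ_isCovariant X).toIsToeplitz⟩ m).1

/-- `ξ ∈ X^{⊗m}` is non-returning if `t^m(ξ)* t^n(η) t^m(ξ) = 0` in `O_X` whenever `0 < n < m`
and `η ∈ X^{⊗n}`. -/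
def IsNonReturning {m : ℕ} (ξ : (X.tpow m).carrier) : Prop :=
  ∀ n, 0 < n → n < m → ∀ η : (X.tpow n).carrier,
    star (X.univtPow m ξ) * X.univtPow n η * X.univtPow m ξ = 0

def ConditionS : Prop :=
  ∀ x : B, 0 ≤ x → ∀ n : ℕ, ∀ ε : ℝ, 0 < ε → ∃ m, n < m ∧ ∃ ξ : (X.tpow m).carrier,
    (X.tpow m).norm ξ = 1 ∧ X.IsNonReturning ξ ∧
      ‖x‖ < ‖(X.tpow m).inner ξ ((X.tpow m).left x ξ)‖ + ε

end CuntzPimsner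

end Correspondence

section QuantumGraph

open scoped CStarAlgebra

/-- A faithful state on `B`. -/
structure FaithfulState (B : Type u) [CStarAlgebra B] [PartialOrder B] [StarOrderedRing B] where
  toPositive : B →ₚ[ℂ] ℂ
  map_one : toPositive 1 = 1
  faithful : ∀ x, toPositive (star x * x) = 0 → x = 0

variable {B : Type u} [CStarAlgebra B] [PartialOrder B] [StarOrderedRing B]

namespace FaithfulState

instance : CoeFun (FaithfulState B) (fun _ => B → ℂ) := ⟨fun ψ => ψ.toPositive⟩

variable (ψ : FaithfulState B)

/-- `ψ` is tracial if `ψ(xy) = ψ(yx)`. -/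
def IsTracial : Prop := ∀ x y, ψ (x * y) = ψ (y * x)

/-- The space `L²(B, ψ)`: `B` with the inner product `⟨x, y⟩ = ψ(x* y)`. -/
def L2 (_ψ : FaithfulState B) : Type u := B

instance : AddCommGroup ψ.L2 := inferInstanceAs (AddCommGroup B)
instance : Module ℂ ψ.L2 := inferInstanceAs (Module ℂ B)
instance [h : FiniteDimensional ℂ B] : FiniteDimensional ℂ ψ.L2 := h

/-- The identity map `B → L²(B, ψ)`. -/
def toL2 : B ≃ₗ[ℂ] ψ.L2 := LinearEquiv.refl ℂ B

theorem star_apply_star_mul (x y : B) : star (ψ (star y * x)) = ψ (star x * y) := by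
  have := map_star ψ.toPositive (star y * x)
  rw [star_mul, star_star] at this
  exact this.symm

@[reducible] def innerCore : InnerProductSpace.Core ℂ ψ.L2 where
  inner x y := ψ (star (ψ.toL2.symm x) * ψ.toL2.symm y)
  conj_inner_symm x y := ψ.star_apply_star_mul _ _
  re_inner_nonneg x := by
    have := ψ.toPositive.map_nonneg (star_mul_self_nonneg (ψ.toL2.symm x))
    exact (Complex.le_def.mp this).1
  add_left x y z := by simp [add_mul]
  smul_left x y r := by simp
  definite x h := (LinearEquiv.map_eq_zero_iff _).mp (ψ.faithful _ h)

instance : NormedAddCommGroup ψ.L2 := ψ.innerCore.toNormedAddCommGroup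
instance : InnerProductSpace ℂ ψ.L2 := InnerProductSpace.ofCore ψ.innerCore.toCore

theorem inner_toL2 (x y : B) : inner ℂ (ψ.toL2 x) (ψ.toL2 y) = ψ (star x * y) := rfl

/-- The multiplication `m : L²(B ⊗ B, ψ ⊗ ψ) → L²(B, ψ)`. -/
def mulL2 : ψ.L2 ⊗[ℂ] ψ.L2 →ₗ[ℂ] ψ.L2 :=
  ψ.toL2.toLinearMap ∘ₗ LinearMap.mul' ℂ B ∘ₗ (TensorProduct.congr ψ.toL2 ψ.toL2).symm.toLinearMap

section

variable [FiniteDimensional ℂ B]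

/-- The adjoint `m* : B → B ⊗ B` of the multiplication with respect to `ψ`. -/
def comul : B →ₗ[ℂ] B ⊗[ℂ] B :=
  (TensorProduct.congr ψ.toL2 ψ.toL2).symm.toLinearMap ∘ₗ LinearMap.adjoint ψ.mulL2 ∘ₗ
    ψ.toL2.toLinearMap

/-- `ψ` is a `δ`-form if `m m* = δ² id`. -/
def IsDeltaForm (δ : ℝ) : Prop :=
  0 < δ ∧ LinearMap.mul' ℂ B ∘ₗ ψ.comul = ((δ : ℂ) ^ 2) • LinearMap.id

end

/-- The form `⟨x ⊗ y | x' ⊗ y'⟩ = y* ψ(x* x') y'` on `B ⊗ B`. -/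
def tensorInner : B ⊗[ℂ] B →ₗ⋆[ℂ] B ⊗[ℂ] B →ₗ[ℂ] B :=
  TensorProduct.lift <| LinearMap.mk₂'ₛₗ (starRingEnd ℂ) (starRingEnd ℂ)
    (fun x y => TensorProduct.lift <| LinearMap.mk₂ ℂ
      (fun x' y' => ψ (star x * x') • (star y * y'))
      (by intros; simp [mul_add, add_smul]) (by intros; simp [smul_smul])
      (by intros; simp [mul_add])
      (by intros; rw [mul_smul_comm, smul_comm]))
    (by intros; ext; simp [add_mul, add_smul]) (by intros; ext; simp [smul_smul])
    (by intros; ext; simp [add_mul])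
    (by intros; ext; simp [smul_smul, mul_comm])

@[simp] theorem tensorInner_tmul (x y x' y' : B) :
    ψ.tensorInner (x ⊗ₜ y) (x' ⊗ₜ y') = ψ (star x * x') • (star y * y') := rfl

/-- The map `x ⊗ y ↦ ⟨e, x⟩ y`. -/
def coord (e : ψ.L2) : B ⊗[ℂ] B →ₗ[ℂ] B :=
  TensorProduct.lift (LinearMap.lsmul ℂ B ∘ₗ
    ((innerSL ℂ e).toLinearMap ∘ₗ ψ.toL2.toLinearMap))

theorem coord_tmul (e : ψ.L2) (x y : B) :
    ψ.coord e (x ⊗ₜ y) = (inner ℂ e (ψ.toL2 x) : ℂ) • y := rfl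

variable [FiniteDimensional ℂ B]

theorem tensorInner_eq (z w : B ⊗[ℂ] B) : ψ.tensorInner z w =
    ∑ i, star (ψ.coord (stdOrthonormalBasis ℂ ψ.L2 i) z) *
      ψ.coord (stdOrthonormalBasis ℂ ψ.L2 i) w := by
  induction z with
  | zero => simp
  | add z z' hz hz' => simp [hz, hz', add_mul, Finset.sum_add_distrib]
  | tmul x y =>
    induction w with
    | zero => simp
    | add w w' hw hw' => simp only [map_add, hw, hw', mul_add, Finset.sum_add_distrib]
    | tmul x' y' =>
      rw [tensorInner_tmul, ← inner_toL2,
        ← (stdOrthonormalBasis ℂ ψ.L2).sum_inner_mul_inner, Finset.sum_smul]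
      refine Finset.sum_congr rfl fun i _ => ?_
      rw [coord_tmul, coord_tmul, star_smul, smul_mul_smul_comm]
      congr 2
      exact (inner_conj_symm _ _).symm

theorem sum_coord (z : B ⊗[ℂ] B) :
    z = ∑ i, (ψ.toL2.symm (stdOrthonormalBasis ℂ ψ.L2 i)) ⊗ₜ[ℂ]
      ψ.coord (stdOrthonormalBasis ℂ ψ.L2 i) z := by
  induction z with
  | zero => simp
  | add z z' hz hz' =>
    simp only [map_add, TensorProduct.tmul_add, Finset.sum_add_distrib]
    rw [← hz, ← hz']
  | tmul x y =>
    simp only [coord_tmul, ← TensorProduct.smul_tmul, ← map_smul]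
    rw [← TensorProduct.sum_tmul, ← map_sum, (stdOrthonormalBasis ℂ ψ.L2).sum_repr']
    simp

/-- The correspondence `B ⊗_ψ B`. -/
def tensorCorrespondence : Correspondence B where
  carrier := B ⊗[ℂ] B
  left := LinearMap.rTensorHom B ∘ₗ LinearMap.mul ℂ B
  right := LinearMap.lTensorHom B ∘ₗ (LinearMap.mul ℂ B).flip
  inner := ψ.tensorInner
  left_mul b c z := by
    induction z with
    | zero => simp
    | add z w hz hw => simp only [map_add, hz, hw]
    | tmul x y => simp [mul_assoc]
  right_mul b c z := by
    induction z with
    | zero => simp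
    | add z w hz hw => simp only [map_add, hz, hw]
    | tmul x y => simp [mul_assoc]
  right_one z := by
    induction z with
    | zero => simp
    | add z w hz hw => simp only [map_add, hz, hw]
    | tmul x y => simp
  star_inner z w := by simp [tensorInner_eq]
  inner_right b z w := by
    induction z with
    | zero => simp
    | add z z' hz hz' => simp only [map_add, LinearMap.add_apply, hz, hz', add_mul]
    | tmul x y =>
      induction w with
      | zero => simp
      | add w w' hw hw' => simp only [map_add, hw, hw', add_mul]
      | tmul x' y' => simp [mul_assoc]
  inner_left b z w := by
    induction z with
    | zero => simp
    | add z z' hz hz' => simp only [map_add, LinearMap.add_apply, hz, hz']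
    | tmul x y =>
      induction w with
      | zero => simp
      | add w w' hw hw' => simp only [map_add, hw, hw']
      | tmul x' y' => simp [mul_assoc]
  inner_self_nonneg z := by
    rw [tensorInner_eq]
    exact Finset.sum_nonneg fun i _ => star_mul_self_nonneg _
  eq_zero_of_inner_self z h := by
    rw [tensorInner_eq, Finset.sum_eq_zero_iff_of_nonneg
      (fun i _ => star_mul_self_nonneg _)] at h
    rw [ψ.sum_coord z]
    refine Finset.sum_eq_zero fun i hi => ?_
    rw [CStarRing.star_mul_self_eq_zero_iff _ |>.mp (h i hi), TensorProduct.tmul_zero]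

end FaithfulState

variable [FiniteDimensional ℂ B]

/-- A finite quantum graph `(B, ψ, A)`: `ψ` is a `δ`-form and `A` is completely positive and
quantum Schur idempotent, `m (A ⊗ A) m* = δ² A`. -/
structure QuantumGraph (B : Type u) [CStarAlgebra B] [PartialOrder B] [StarOrderedRing B]
    [FiniteDimensional ℂ B] where
  ψ : FaithfulState B
  δ : ℝ
  isDeltaForm : ψ.IsDeltaForm δ
  A : B →CP B
  schur : LinearMap.mul' ℂ B ∘ₗ TensorProduct.map A.toLinearMap A.toLinearMap ∘ₗ ψ.comul
    = ((δ : ℂ) ^ 2) • A.toLinearMap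

namespace QuantumGraph

variable (G : QuantumGraph B)

/-- `ε_G = δ⁻² (id ⊗ A) m*(1)`. -/
def edgeElement : G.ψ.tensorCorrespondence.carrier :=
  (((G.δ : ℂ) ^ 2)⁻¹ • (G.A.toLinearMap.lTensor B (G.ψ.comul 1)) : B ⊗[ℂ] B)

/-- The subspace `span {x · ε_G · y : x, y ∈ B}` of `B ⊗_ψ B`. -/
def edgeSubspace : Submodule ℂ G.ψ.tensorCorrespondence.carrier :=
  Submodule.span ℂ {z | ∃ x y : B, z = G.ψ.tensorCorrespondence.right y
    (G.ψ.tensorCorrespondence.left x G.edgeElement)}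

theorem left_mem_edgeSubspace (b : B) (z : G.ψ.tensorCorrespondence.carrier)
    (hz : z ∈ G.edgeSubspace) : G.ψ.tensorCorrespondence.left b z ∈ G.edgeSubspace := by
  refine Submodule.span_le (p := G.edgeSubspace.comap (G.ψ.tensorCorrespondence.left b)) |>.mpr
    ?_ hz
  rintro _ ⟨x, y, rfl⟩
  refine Submodule.subset_span ⟨b * x, y, ?_⟩
  rw [Correspondence.left_right, Correspondence.left_mul]

theorem right_mem_edgeSubspace (b : B) (z : G.ψ.tensorCorrespondence.carrier)
    (hz : z ∈ G.edgeSubspace) : G.ψ.tensorCorrespondence.right b z ∈ G.edgeSubspace := by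
  refine Submodule.span_le (p := G.edgeSubspace.comap (G.ψ.tensorCorrespondence.right b)) |>.mpr
    ?_ hz
  rintro _ ⟨x, y, rfl⟩
  exact Submodule.subset_span ⟨x, y * b, (Correspondence.right_mul _ y b _).symm⟩

/-- The quantum edge correspondence `E_G`. -/
def edgeCorrespondence : Correspondence B :=
  G.ψ.tensorCorrespondence.sub G.edgeSubspace G.left_mem_edgeSubspace G.right_mem_edgeSubspace

/-- `ε_G` as a vector of `E_G`. -/
def edgeVector : G.edgeCorrespondence.carrier :=
  ⟨G.edgeElement, Submodule.subset_span ⟨1, 1, by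
    have h : G.ψ.tensorCorrespondence.left 1 G.edgeElement = G.edgeElement := by
      change LinearMap.rTensor B (LinearMap.mul ℂ B 1) _ = _
      rw [show LinearMap.mul ℂ B 1 = LinearMap.id from by ext; simp, LinearMap.rTensor_id]
      rfl
    rw [h, Correspondence.right_one]⟩⟩

/-- The vector `(p · ε_G · q) ⊗ (ε_G · q) ⊗ ⋯ ⊗ (ε_G · q)` of `E_G^{⊗(k+1)}`. -/
def pathVector (p q : B) (k : ℕ) : (G.edgeCorrespondence.tpow (k + 1)).carrier :=
  G.edgeCorrespondence.powTensor
    (G.edgeCorrespondence.right q (G.edgeCorrespondence.left p G.edgeVector))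
    (G.edgeCorrespondence.right q G.edgeVector) k

end QuantumGraph

/-- `B = M_n(ℂ) ⊕ M_n(ℂ) ⊕ M_n(ℂ)`, with the C*-norm and the C*-order. -/
abbrev ThreeBlocks (n : ℕ) : Type := Fin 3 → Matrix (Fin n) (Fin n) ℂ

/-- `ψ` is a tracial `δ`-form, and
`A(x₁ ⊕ x₂ ⊕ x₃) = (x₁ + x₂ + x₃) ⊕ (x₁ + x₂) ⊕ 0`. -/
def IsThreeBlockGraph {n : ℕ} (G : QuantumGraph (ThreeBlocks n)) : Prop :=
  G.ψ.IsTracial ∧ ∀ x : ThreeBlocks n, G.A x = ![x 0 + x 1 + x 2, x 0 + x 1, 0]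

/-- The central projection `1_a` onto the `a`-th summand. -/
def blockProj {n : ℕ} (a : Fin 3) : ThreeBlocks n := Pi.single a 1

end QuantumGraph

end QuantumGraphs

end

open QuantumGraphs

namespace QuantumGraphs

universe u

/-! ### Path vectors in tensor powers and their images in the Cuntz–Pimsner algebra -/

namespace Correspondence

variable {B : Type u} [CStarAlgebra B] [PartialOrder B] [StarOrderedRing B]

/-! The map `A` is a directed graph on three vertices, with the identity of `M_n` on every edge.
Numbering the blocks 0, 1, 2, the edges are 0→0, 1→0, 2→0, 0→1, 1→1. Each vertex `a` has an edge to
some `b ≠ a` that carries a loop, and the path vector takes that edge once and then runs round the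
loop.

Such a path cannot return. Let `T = t^m(ξ)` with first edge leaving `a` and all edges ending in `b`,
and cut it after `n < m` edges, `T = S R`. Then `S = S π(1_b)` and `T = π(1_a) T`, while `S* t^n(ζ)`
lies in `π(B)` because both factors have degree `n`. Hence `T* t^n(ζ) T = R* π(1_b c 1_a) T` for
some `c ∈ B`, and `1_b c 1_a = 0` since `1_a` and `1_b` are central and orthogonal. Only the
Toeplitz relations enter (`isNonReturning_powTensor`).

Nor does the path lose norm. Schur idempotency gives `⟨ε | y · ε⟩ = δ⁻² A(y)` (`inner_edgeVector`),
so the first edge carries `x_a` into block `b` with a factor `δ⁻²`, and each turn of the loop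
contributes another `δ⁻²` (`inner_left_pathVector`). After multiplication of the vector by `δ^m`,
the inner product is exactly `x_a` placed in block `b`; choosing `a` with `‖x_a‖ = ‖x‖` gives
equality of norms, hence Condition (S).

For the state: a faithful tracial state is `∑ l_a Tr` with `l_a > 0`, and `m m*` multiplies block
`a` by `n / l_a`. The `δ`-form condition makes the weights equal, and `ψ(1) = 1` then forces `l_a =
1/(3n)` and `δ² = 3n²`. -/

theorem IsToeplitz.right {X : Correspondence B} {D : Type*} [NonUnitalCStarAlgebra D]
    {π : B →⋆ₙₐ[ℂ] D} {t : X.carrier →ₗ[ℂ] D} (h : X.IsToeplitz π t) (b : B) (ξ : X.carrier) :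
    t (X.right b ξ) = t ξ * π b := by
  -- With `d` the difference of the two sides, all four terms of `d* d` equal `π(b* ⟨ξ | ξ⟩ b)` up
  -- to sign, and they cancel.
  rw [← sub_eq_zero, ← CStarRing.star_mul_self_eq_zero_iff, star_sub, sub_mul, mul_sub, mul_sub,
    star_mul, h.inner, ← mul_assoc, h.inner, mul_assoc, h.inner, mul_assoc (star (π b)),
    ← mul_assoc (star (t ξ)), h.inner, X.inner_right, X.inner_right, X.inner_right_left,
    ← map_star]
  simp [mul_assoc]

variable [FiniteDimensional ℂ B] {X : Correspondence B}

/-- Since `⟨x ⊗ y | b · x ⊗ y⟩ = ⟨y | ⟨x | b · x⟩ · y⟩`, each factor passes one element of `B` on to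
the next; a path thus acts as a composite of maps `B → B`, one per edge. -/
theorem inner_left_powTensor (ξ η : X.carrier) (k : ℕ) (b : B) :
    (X.tpow (k + 1)).inner (X.powTensor ξ η k) ((X.tpow (k + 1)).left b (X.powTensor ξ η k))
      = (fun c => X.inner η (X.left c η))^[k] (X.inner ξ (X.left b ξ)) := by
  induction k generalizing ξ b with
  | zero => rfl
  | succ k ih => exact ih η _

theorem left_powTensor {ξ : X.carrier} {p : B} (hp : X.left p ξ = ξ) (η : X.carrier) (k : ℕ) :
    (X.tpow (k + 1)).left p (X.powTensor ξ η k) = X.powTensor ξ η k := by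
  cases k with
  | zero => exact hp
  | succ k =>
    conv_rhs => rw [← hp]
    rfl

theorem univtPow_powTensor_succ (ξ η : X.carrier) (k : ℕ) :
    X.univtPow (k + 2) (X.powTensor ξ η (k + 1))
      = X.univt ξ * X.univtPow (k + 1) (X.powTensor η η k) := rfl

/-- Cuts a path of `j + k + 2` edges after the first `j + 1`; the special edge `ξ` stays in the
front piece. -/
theorem univtPow_powTensor_add (ξ η : X.carrier) (j k : ℕ) :
    X.univtPow (j + k + 1 + 1) (X.powTensor ξ η (j + k + 1))
      = X.univtPow (j + 1) (X.powTensor ξ η j) * X.univtPow (k + 1) (X.powTensor η η k) := by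
  induction j generalizing ξ with
  | zero =>
    rw [univtPow_powTensor_succ, Nat.zero_add]
    rfl
  | succ j ih =>
    rw [univtPow_powTensor_succ, univtPow_powTensor_succ, mul_assoc, ← ih]
    rw [Nat.add_right_comm j 1 k]

omit [FiniteDimensional ℂ B] in
theorem univt_mul_univπ (ξ : X.carrier) (b : B) :
    X.univt ξ * X.univπ b = X.univt (X.right b ξ) :=
  ((univ_isCovariant X).toIsToeplitz.right b ξ).symm

omit [FiniteDimensional ℂ B] in
theorem univπ_mul_univt (ξ : X.carrier) (b : B) :
    X.univπ b * X.univt ξ = X.univt (X.left b ξ) :=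
  (univ_isCovariant X).left b ξ

theorem univtPow_powTensor_mul_univπ {ξ η : X.carrier} {q : B} (hξ : X.right q ξ = ξ)
    (hη : X.right q η = η) (k : ℕ) :
    X.univtPow (k + 1) (X.powTensor ξ η k) * X.univπ q
      = X.univtPow (k + 1) (X.powTensor ξ η k) := by
  induction k generalizing ξ with
  | zero => exact (univt_mul_univπ ξ q).trans (by rw [hξ]; rfl)
  | succ k ih => rw [univtPow_powTensor_succ, mul_assoc, ih hη]

theorem univπ_mul_univtPow_powTensor {ξ η : X.carrier} {p : B} (hξ : X.left p ξ = ξ) (k : ℕ) :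
    X.univπ p * X.univtPow (k + 1) (X.powTensor ξ η k)
      = X.univtPow (k + 1) (X.powTensor ξ η k) := by
  cases k with
  | zero => exact (univπ_mul_univt ξ p).trans (by rw [hξ]; rfl)
  | succ k => rw [univtPow_powTensor_succ, ← mul_assoc, univπ_mul_univt, hξ]

/-- If the first edge starts in `p` and all edges end in `q`, where `q B p = 0`, then the path
`ξ ⊗ η ⊗ ⋯ ⊗ η` does not return. -/
theorem isNonReturning_powTensor {ξ η : X.carrier} {p q : B} (hp : X.left p ξ = ξ)
    (hqξ : X.right q ξ = ξ) (hqη : X.right q η = η) (hq : star q = q)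
    (hpq : ∀ b, q * b * p = 0) (k : ℕ) : X.IsNonReturning (X.powTensor ξ η k) := by
  intro n hn hnk ζ
  -- `powTensor ξ η k` has `k + 1` edges, so cutting after `n = j + 1` of them leaves `l + 1` edges
  -- with `k = j + l + 1`.
  obtain ⟨j, rfl⟩ : ∃ j, n = j + 1 := ⟨n - 1, by omega⟩
  obtain ⟨l, rfl⟩ : ∃ l, k = j + l + 1 := ⟨k - j - 1, by omega⟩
  set S := X.univtPow (j + 1) (X.powTensor ξ η j) with hS
  set R := X.univtPow (l + 1) (X.powTensor η η l)
  have hinner : star S * X.univtPow (j + 1) ζ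
      = X.univπ ((X.tpow (j + 1)).inner (X.powTensor ξ η j) ζ) :=
    (X.toeplitzPow ⟨univt X, (univ_isCovariant X).toIsToeplitz⟩ (j + 1)).2.inner _ _
  have hSq : star S = X.univπ q * star S := by
    conv_lhs => rw [hS, ← univtPow_powTensor_mul_univπ hqξ hqη, star_mul, ← map_star, hq]
  have hpT := univπ_mul_univtPow_powTensor (η := η) hp (j + l + 1)
  -- `S*` meets a vector of its own degree, so the product falls into `π(B)`, where `q B p = 0`
  -- applies.
  have h0 : X.univπ q * star S * X.univtPow (j + 1) ζ * X.univπ p = 0 := by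
    rw [mul_assoc _ (star S), hinner, ← map_mul, ← map_mul, hpq, map_zero]
  rw [← hpT, mul_assoc, ← mul_assoc _ (X.univπ p), ← mul_assoc, hpT, univtPow_powTensor_add,
    star_mul, hSq, mul_assoc (star R), ← mul_assoc (_ * star S), h0, mul_zero, zero_mul]
  

theorem IsNonReturning.smul {m : ℕ} {ξ : (X.tpow m).carrier} (h : X.IsNonReturning ξ) (c : ℂ) :
    X.IsNonReturning (c • ξ) := fun n hn hnm ζ => by
  rw [map_smul, star_smul, smul_mul_assoc, smul_mul_assoc, mul_smul_comm, h n hn hnm ζ, smul_zero,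
    smul_zero]

end Correspondence

/-! ### The adjoint of multiplication for a tracial state -/

namespace FaithfulState

variable {B : Type u} [CStarAlgebra B] [PartialOrder B] [StarOrderedRing B]
  [FiniteDimensional ℂ B] {ψ : FaithfulState B} {ι : Type*} [Fintype ι] {w : ι → ℝ} {f : ι → B}

/-- `m*(x) = ∑ᵢ wᵢ x fᵢ ⊗ fᵢ*` for a weighted orthonormal basis `f` of `L²(B, ψ)`. -/
theorem comul_eq_sum (hψ : ψ.IsTracial)
    (hf : ∀ x, x = ∑ i, (w i * ψ (star (f i) * x)) • f i) (x : B) :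
    ψ.comul x = ∑ i, (w i : ℂ) • ((x * f i) ⊗ₜ[ℂ] star (f i)) := by
  rw [comul, LinearMap.comp_apply, LinearMap.comp_apply, LinearEquiv.coe_coe,
    LinearEquiv.symm_apply_eq]
  apply TensorProduct.ext_iff_inner_left.mpr
  intro u v
  rw [← inner_conj_symm, LinearMap.adjoint_inner_left]
  obtain ⟨u, rfl⟩ := ψ.toL2.surjective u
  obtain ⟨v, rfl⟩ := ψ.toL2.surjective v
  have h1 : ψ.mulL2 (ψ.toL2 u ⊗ₜ ψ.toL2 v) = ψ.toL2 (u * v) := by simp [mulL2]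
  rw [h1]
  simp only [map_sum, map_smul, TensorProduct.congr_tmul, inner_sum, inner_smul_right,
    TensorProduct.inner_tmul]
  -- Traciality moves `v*` to the right of `u* x`, where it is expanded in the frame; its
  -- coefficients `ψ(fᵢ* v*)` are the inner products `⟨v, fᵢ*⟩`.
  rw [inner_conj_symm, LinearEquiv.coe_coe, inner_toL2, star_mul, mul_assoc, hψ, hf (star v),
    Finset.mul_sum, map_sum]
  refine Finset.sum_congr rfl fun i _ => ?_
  rw [mul_smul_comm, map_smul, inner_toL2, inner_toL2, hψ (star v), smul_eq_mul, mul_assoc (star u)]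
  ring

/-- Covers both the `δ`-form condition (`A₁ = A₂ = id`) and the Schur condition (`A₁ = A₂ = A`). -/
theorem lmul_comul (hψ : ψ.IsTracial) (hf : ∀ x, x = ∑ i, (w i * ψ (star (f i) * x)) • f i)
    (A₁ A₂ : B →ₗ[ℂ] B) (x : B) :
    LinearMap.mul' ℂ B (TensorProduct.map A₁ A₂ (ψ.comul x))
      = ∑ i, (w i : ℂ) • (A₁ (x * f i) * A₂ (star (f i))) := by
  simp [comul_eq_sum hψ hf]

omit [FiniteDimensional ℂ B] in
theorem ext_apply {ψ φ : FaithfulState B} (h : ∀ x, ψ x = φ x) : ψ = φ := by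
  cases ψ
  cases φ
  congr
  exact DFunLike.ext _ _ h

end FaithfulState

/-! ### The inner product of the edge vector -/

namespace QuantumGraph

variable {B : Type u} [CStarAlgebra B] [PartialOrder B] [StarOrderedRing B]
  [FiniteDimensional ℂ B] {G : QuantumGraph B} {ι : Type*} [Fintype ι] {w : ι → ℝ} {f : ι → B}

/-- `⟨ε_G | y · ε_G⟩ = δ⁻² A(y)`. -/
theorem inner_edgeVector (hψ : G.ψ.IsTracial)
    (hf : ∀ x, x = ∑ i, (w i * G.ψ (star (f i) * x)) • f i)
    (hA : ∀ x, star (G.A.toLinearMap x) = G.A.toLinearMap (star x)) (y : B) :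
    G.edgeCorrespondence.inner G.edgeVector (G.edgeCorrespondence.left y G.edgeVector)
      = ((G.δ : ℂ) ^ 2)⁻¹ • G.A.toLinearMap y := by
  have hδ : (G.δ : ℂ) ^ 2 ≠ 0 := pow_ne_zero 2 (Complex.ofReal_ne_zero.mpr G.isDeltaForm.1.ne')
  have hs := LinearMap.congr_fun G.schur y
  rw [LinearMap.comp_apply, LinearMap.comp_apply, FaithfulState.lmul_comul hψ hf,
    LinearMap.smul_apply] at hs
  change G.ψ.tensorInner G.edgeElement ((LinearMap.mul ℂ B y).rTensor B G.edgeElement) = _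
  have he : G.edgeElement = ((G.δ : ℂ) ^ 2)⁻¹ •
      ∑ i, (w i : ℂ) • (f i ⊗ₜ[ℂ] G.A.toLinearMap (star (f i))) := by
    rw [edgeElement, FaithfulState.comul_eq_sum hψ hf]
    simp only [map_sum, map_smul, LinearMap.lTensor_tmul, one_mul]
    rfl
  rw [he]
  simp only [map_smul, map_sum, LinearMap.rTensor_tmul, LinearMap.map_smulₛₗ,
    LinearMap.smul_apply, LinearMap.sum_apply, FaithfulState.tensorInner_tmul, hA, star_star,
    LinearMap.mul_apply_apply]
  -- The inner product is a double sum over the frame. The sum over `i` is the frame expansion of `y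
  -- fⱼ` pushed through `A`.
  have h1 : ∀ j, ∑ i, (starRingEnd ℂ) (w i : ℂ) • G.ψ (star (f i) * (y * f j)) •
      (G.A.toLinearMap (f i) * G.A.toLinearMap (star (f j)))
      = G.A.toLinearMap (y * f j) * G.A.toLinearMap (star (f j)) := fun j => by
    conv_rhs => rw [hf (y * f j), map_sum, Finset.sum_mul]
    refine Finset.sum_congr rfl fun i _ => ?_
    rw [map_smul, smul_mul_assoc, smul_smul, Complex.conj_ofReal]
  simp only [h1]
  simp_rw [smul_comm _ ((starRingEnd ℂ) ((G.δ : ℂ) ^ 2)⁻¹)]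
  -- The remaining sum over `j` is `m (A ⊗ A) m*(y) = δ² A(y)`, which cancels one of the two factors
  -- `δ⁻²`.
  rw [← Finset.smul_sum, hs, map_inv₀, map_pow, Complex.conj_ofReal, inv_smul_smul₀ hδ]

end QuantumGraph
end QuantumGraphs

/-! ### Tracial `δ`-forms on three matrix blocks -/

namespace QuantumGraphs.QuantumGraph

open scoped CStarAlgebra

variable {n : ℕ}

/-- The matrix unit `e_{ij}` of the `a`-th summand. -/
def blockUnit (s : Fin 3 × Fin n × Fin n) : ThreeBlocks n :=
  Pi.single s.1 (Matrix.single s.2.1 s.2.2 1)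

theorem star_blockUnit (a : Fin 3) (i j : Fin n) :
    star (blockUnit (a, i, j)) = blockUnit (a, j, i) := by
  rw [blockUnit, ← Pi.single_star, Matrix.star_eq_conjTranspose, Matrix.conjTranspose_single,
    star_one]
  rfl

theorem blockUnit_mul (a : Fin 3) (i j k : Fin n) :
    blockUnit (a, i, j) * blockUnit (a, j, k) = blockUnit (a, i, k) := by
  simp [blockUnit, ← Pi.single_mul]

theorem sum_blockUnit (x : ThreeBlocks n) : x = ∑ s, x s.1 s.2.1 s.2.2 • blockUnit s := by
  simp only [Fintype.sum_prod_type]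
  funext a
  rw [Finset.sum_apply, Finset.sum_eq_single a]
  · conv_lhs => rw [Matrix.matrix_eq_sum_single (x a)]
    simp [blockUnit, Matrix.smul_single]
  · intro b _ hb
    simp [blockUnit, hb.symm]
  · simp

theorem sum_blockUnit_mul (a : Fin 3) :
    ∑ i : Fin n, ∑ j : Fin n, blockUnit (a, i, j) * star (blockUnit (a, i, j))
      = (n : ℂ) • blockProj a := by
  simp only [star_blockUnit, blockUnit_mul, Finset.sum_const, Finset.card_univ, Fintype.card_fin]
  rw [← Finset.smul_sum, ← Nat.cast_smul_eq_nsmul ℂ, blockProj]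
  congr 1
  rw [← Matrix.sum_single_one]
  exact (map_sum (AddMonoidHom.single (fun _ : Fin 3 => Matrix (Fin n) (Fin n) ℂ) a) _ _).symm

theorem mul_blockProj (x : ThreeBlocks n) (a : Fin 3) : x * blockProj a = Pi.single a (x a) := by
  funext b
  obtain rfl | hb := eq_or_ne b a
  · simp [blockProj]
  · simp [blockProj, hb]

theorem blockProj_mul (x : ThreeBlocks n) (a : Fin 3) : blockProj a * x = Pi.single a (x a) := by
  funext b
  obtain rfl | hb := eq_or_ne b a
  · simp [blockProj]
  · simp [blockProj, hb]

variable {ψ : FaithfulState (ThreeBlocks n)} {l : Fin 3 → ℝ}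

theorem exists_eq_sum_trace (hn : 1 ≤ n) (hψ : ψ.IsTracial) :
    ∃ l : Fin 3 → ℝ, (∀ a, 0 < l a) ∧ ∀ x, ψ x = ∑ a, (l a : ℂ) * (x a).trace := by
  let o : Fin n := ⟨0, hn⟩
  have hpos : ∀ a, 0 ≤ ψ (blockUnit (a, o, o)) := fun a => by
    have := ψ.toPositive.map_nonneg (star_mul_self_nonneg (blockUnit (a, o, o)))
    rwa [star_blockUnit, blockUnit_mul] at this
  have hne : ∀ a, ψ (blockUnit (a, o, o)) ≠ 0 := fun a h => by
    have := ψ.faithful (blockUnit (a, o, o)) (by rw [star_blockUnit, blockUnit_mul, h])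
    have := congrFun (congrFun (congrFun this a) o) o
    simp [blockUnit] at this
  have hre : ∀ a, ((ψ (blockUnit (a, o, o))).re : ℂ) = ψ (blockUnit (a, o, o)) := fun a =>
    (Complex.eq_re_of_ofReal_le (hpos a)).symm
  refine ⟨fun a => (ψ (blockUnit (a, o, o))).re, fun a => ?_, fun x => ?_⟩
  · have := (hpos a).lt_of_ne (hne a).symm
    exact (Complex.lt_def.mp this).1
  · obtain ⟨d, hd⟩ : ∃ d : Fin 3 → ℂ, ∀ a, ψ (blockUnit (a, o, o)) = d a := ⟨_, fun _ => rfl⟩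
    -- Factor `e_ij = e_io e_oj` and swap by traciality: `e_oj e_io` is `e_oo` if `i = j` and `0`
    -- otherwise.
    have hij : ∀ a i j, ψ (blockUnit (a, i, j)) = if i = j then d a else 0 := by
      intro a i j
      rw [← blockUnit_mul a i o j, hψ]
      split_ifs with h
      · rw [h, blockUnit_mul, hd]
      · simp [blockUnit, ← Pi.single_mul, Matrix.single_mul_single_of_ne, Ne.symm h]
    conv_lhs => rw [sum_blockUnit x, map_sum]
    simp only [hd] at hre ⊢
    simp only [hre]
    simp only [Fintype.sum_prod_type, map_smul, hij]
    refine Finset.sum_congr rfl fun a _ => ?_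
    simp only [Matrix.trace, Matrix.diag_apply, smul_eq_mul, mul_ite, mul_zero, Finset.sum_ite_eq,
      Finset.mem_univ, if_true, Finset.mul_sum]
    exact Finset.sum_congr rfl fun i _ => mul_comm _ _

/-- The matrix units are orthogonal in `L²(B, ψ)`, and those of block `a` have squared length `l a`;
hence the weights `(l a)⁻¹`. -/
theorem blockUnit_frame (hl : ∀ a, 0 < l a)
    (h : ∀ x, ψ x = ∑ a, (l a : ℂ) * (x a).trace) (x : ThreeBlocks n) :
    x = ∑ s : Fin 3 × Fin n × Fin n,
      (((l s.1)⁻¹ : ℝ) * ψ (star (blockUnit s) * x)) • blockUnit s := by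
  conv_lhs => rw [sum_blockUnit x]
  refine Finset.sum_congr rfl fun ⟨a, i, j⟩ _ => ?_
  congr 1
  rw [h, star_blockUnit, Finset.sum_eq_single a]
  · have : (l a : ℂ) ≠ 0 := Complex.ofReal_ne_zero.mpr (hl a).ne'
    simp [blockUnit, Matrix.trace_single_mul, this]
  · intro b _ hb
    simp [blockUnit, hb]
  · simp

/-- Each block contributes `(l a)⁻¹ x ∑ e_ij e_ij*`, and `∑ e_ij e_ij* = n 1_a` because every `e_ii`
occurs `n` times. -/
theorem lmul_comul_self (hψ : ψ.IsTracial) (hl : ∀ a, 0 < l a)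
    (h : ∀ x, ψ x = ∑ a, (l a : ℂ) * (x a).trace) (x : ThreeBlocks n) (a : Fin 3) :
    LinearMap.mul' ℂ _ (ψ.comul x) a = ((n / l a : ℝ) : ℂ) • x a := by
  have := FaithfulState.lmul_comul hψ (blockUnit_frame hl h) LinearMap.id LinearMap.id x
  rw [TensorProduct.map_id] at this
  simp only [LinearMap.id_apply, Fintype.sum_prod_type, mul_assoc] at this
  simp only [← Finset.smul_sum, ← Finset.mul_sum, sum_blockUnit_mul, mul_smul_comm,
    mul_blockProj] at this
  rw [this]
  fin_cases a <;> simp [Fin.sum_univ_three, smul_smul, div_eq_inv_mul]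

theorem isDeltaForm_iff (hn : 1 ≤ n) (hψ : ψ.IsTracial) (hl : ∀ a, 0 < l a)
    (h : ∀ x, ψ x = ∑ a, (l a : ℂ) * (x a).trace) (δ : ℝ) :
    ψ.IsDeltaForm δ ↔ 0 < δ ∧ ∀ a, n / l a = δ ^ 2 := by
  refine and_congr_right fun _ => ⟨fun hd a => ?_, fun hd => ?_⟩
  · have h1 := congrFun (congrFun (congrFun (LinearMap.congr_fun hd 1) a) ⟨0, hn⟩) ⟨0, hn⟩
    rw [LinearMap.comp_apply, lmul_comul_self hψ hl h] at h1
    simp only [LinearMap.smul_apply, LinearMap.id_apply, Pi.smul_apply, Matrix.smul_apply,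
      Pi.one_apply, Matrix.one_apply_eq, smul_eq_mul, mul_one] at h1
    exact_mod_cast h1
  · refine LinearMap.ext fun x => funext fun a => ?_
    rw [LinearMap.comp_apply, lmul_comul_self hψ hl h, hd]
    simp

/-- The `δ`-form condition gives `l a = n / δ²` on every block, and `ψ(1) = ∑ l a · n = 1` fixes
`δ²`. -/
theorem eq_trace_of_isDeltaForm (hn : 1 ≤ n) (hψ : ψ.IsTracial) {δ : ℝ} (hδ : ψ.IsDeltaForm δ) :
    δ ^ 2 = 3 * n ^ 2 ∧ ∀ x, ψ x = ∑ a, (((3 * n)⁻¹ : ℝ) : ℂ) * (x a).trace := by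
  obtain ⟨l, hl, h⟩ := exists_eq_sum_trace hn hψ
  have hd := (isDeltaForm_iff hn hψ hl h δ).mp hδ
  have hn0 : (n : ℝ) ≠ 0 := by positivity
  have h1 : (∑ a, l a * n : ℝ) = 1 := by
    have h1 := h 1
    rw [ψ.map_one] at h1
    simp only [Pi.one_apply, Matrix.trace_one, Fintype.card_fin] at h1
    exact_mod_cast h1.symm
  have hla : ∀ a, l a = n / δ ^ 2 := fun a => by
    rw [← hd.2 a, div_div_cancel₀ hn0]
  have hδ2 : δ ^ 2 = 3 * n ^ 2 := by
    have hδ0 : δ ≠ 0 := hd.1.ne'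
    simp only [hla, Finset.sum_const, Finset.card_univ, Fintype.card_fin, nsmul_eq_mul] at h1
    field_simp at h1
    push_cast at h1
    linarith
  refine ⟨hδ2, fun x => ?_⟩
  rw [h]
  refine Finset.sum_congr rfl fun a _ => ?_
  rw [hla, hδ2]
  congr 2
  field_simp

theorem trace_star_mul_self_nonneg (M : Matrix (Fin n) (Fin n) ℂ) : 0 ≤ (star M * M).trace :=
  (Matrix.posSemidef_conjTranspose_mul_self M).trace_nonneg

/-- The state `ψ(x) = (3n)⁻¹ ∑ₐ Tr(xₐ)`. -/
noncomputable def blockTrace (hn : 1 ≤ n) : FaithfulState (ThreeBlocks n) where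
  toPositive := PositiveLinearMap.mk₀
    (∑ a, (((3 * n)⁻¹ : ℝ) : ℂ) • Matrix.traceLinearMap (Fin n) ℂ ℂ ∘ₗ LinearMap.proj a)
    fun x hx => by
      simp only [LinearMap.sum_apply, LinearMap.smul_apply, LinearMap.comp_apply]
      refine Finset.sum_nonneg fun a _ => smul_nonneg ?_ ?_
      · exact_mod_cast (by positivity : (0 : ℝ) ≤ (3 * (n : ℝ))⁻¹)
      · exact (Matrix.nonneg_iff_posSemidef.mp (hx a)).trace_nonneg
  map_one := by
    have : (n : ℂ) ≠ 0 := by exact_mod_cast (by omega : n ≠ 0)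
    change (∑ a, (((3 * n)⁻¹ : ℝ) : ℂ) •
      Matrix.traceLinearMap (Fin n) ℂ ℂ ∘ₗ LinearMap.proj a) (1 : ThreeBlocks n) = 1
    simp
    field_simp
  faithful x hx := by
    change (∑ a, (((3 * n)⁻¹ : ℝ) : ℂ) •
      Matrix.traceLinearMap (Fin n) ℂ ℂ ∘ₗ LinearMap.proj a) (star x * x) = 0 at hx
    rw [← Finset.smul_sum, LinearMap.smul_apply, smul_eq_zero_iff_right
      (by rw [Complex.ofReal_ne_zero]; positivity), LinearMap.sum_apply] at hx
    change ∑ a, (star (x a) * x a).trace = 0 at hx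
    rw [Finset.sum_eq_zero_iff_of_nonneg fun a _ => trace_star_mul_self_nonneg (x a)] at hx
    funext a
    exact Matrix.trace_conjTranspose_mul_self_eq_zero_iff.mp (hx a (Finset.mem_univ a))

theorem blockTrace_apply (hn : 1 ≤ n) (x : ThreeBlocks n) :
    blockTrace hn x = ∑ a, (((3 * n)⁻¹ : ℝ) : ℂ) * (x a).trace := by
  change (∑ a, (((3 * n)⁻¹ : ℝ) : ℂ) • Matrix.traceLinearMap (Fin n) ℂ ℂ ∘ₗ LinearMap.proj a) x = _
  simp

theorem blockTrace_isTracial (hn : 1 ≤ n) : (blockTrace hn).IsTracial := fun x y => by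
  simp only [blockTrace_apply, Pi.mul_apply]
  exact Finset.sum_congr rfl fun a _ => by rw [Matrix.trace_mul_comm]

theorem blockTrace_isDeltaForm (hn : 1 ≤ n) : (blockTrace hn).IsDeltaForm √(3 * n ^ 2) := by
  rw [isDeltaForm_iff hn (blockTrace_isTracial hn) (fun _ => by positivity) (blockTrace_apply hn)]
  refine ⟨by positivity, fun _ => ?_⟩
  rw [Real.sq_sqrt (by positivity)]
  field_simp

theorem existsUnique_tracial_deltaForm (hn : 1 ≤ n) :
    ∃! ψ : FaithfulState (ThreeBlocks n), ψ.IsTracial ∧ ∃ δ : ℝ, ψ.IsDeltaForm δ := by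
  refine ⟨blockTrace hn, ⟨blockTrace_isTracial hn, _, blockTrace_isDeltaForm hn⟩, ?_⟩
  rintro ψ ⟨hψ, δ, hδ⟩
  exact FaithfulState.ext_apply fun x => by
    rw [(eq_trace_of_isDeltaForm hn hψ hδ).2, blockTrace_apply]

/-! ### Complete positivity and Schur idempotency of the adjacency map -/

/-- The homomorphism that moves the `a`-th summand to the `b`-th. -/
noncomputable def blockHom (a b : Fin 3) : ThreeBlocks n →⋆ₙₐ[ℂ] ThreeBlocks n where
  toFun x := Pi.single b (x a)
  map_smul' c x := by simp [Pi.single_smul]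
  map_zero' := by simp
  map_add' x y := by simp [Pi.single_add]
  map_mul' x y := by simp [Pi.single_mul]
  map_star' x := by
    rw [← Pi.single_star]
    rfl

/-- A sum of *-homomorphisms is completely positive. -/
theorem map_cstarMatrix_nonneg_of_eq_sum {A B : Type*} [CStarAlgebra A] [PartialOrder A]
    [StarOrderedRing A] [CStarAlgebra B] [PartialOrder B] [StarOrderedRing B] {ι : Type*}
    (s : Finset ι) (φ : ι → A →⋆ₙₐ[ℂ] B) (f : A → B) (hf : ∀ x, f x = ∑ i ∈ s, φ i x) (k : ℕ)
    (M : CStarMatrix (Fin k) (Fin k) A) (hM : 0 ≤ M) : 0 ≤ M.map f := by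
  obtain ⟨C, rfl⟩ := exists_eq_star_mul_self M hM
  -- Applied entrywise, each `φ i` is again a *-homomorphism, so it sends `C* C` to a square.
  have h : (star C * C).map f
      = ∑ i ∈ s, star (CStarMatrix.mapₙₐ (φ i) C) * CStarMatrix.mapₙₐ (φ i) C := by
    simp only [← map_star, ← map_mul]
    ext i j
    rw [CStarMatrix.map_apply, hf]
    exact (Matrix.sum_apply i j s fun l => CStarMatrix.mapₙₐ (φ l) (star C * C)).symm
  rw [h]
  exact Finset.sum_nonneg fun i _ => star_mul_self_nonneg _

/-- The edges of the graph: the pairs `(a, b)` such that `A` moves the `a`-th summand to the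
`b`-th. -/
def blockEdges : Finset (Fin 3 × Fin 3) := {(0, 0), (1, 0), (2, 0), (0, 1), (1, 1)}

theorem sum_blockHom (x : ThreeBlocks n) :
    ![x 0 + x 1 + x 2, x 0 + x 1, 0] = ∑ e ∈ blockEdges, blockHom e.1 e.2 x := by
  change _ = ∑ e ∈ blockEdges, (Pi.single e.2 (x e.1) : ThreeBlocks n)
  funext b
  rw [blockEdges]
  fin_cases b <;> simp [add_assoc]

noncomputable def blockAdjacency (n : ℕ) : ThreeBlocks n →CP ThreeBlocks n where
  toFun x := ![x 0 + x 1 + x 2, x 0 + x 1, 0]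
  map_add' x y := by simp only [sum_blockHom, map_add, Finset.sum_add_distrib]
  map_smul' c x := by simp only [sum_blockHom, map_smul, Finset.smul_sum, RingHom.id_apply]
  map_cstarMatrix_nonneg' := map_cstarMatrix_nonneg_of_eq_sum _ _ _ sum_blockHom

theorem blockAdjacency_apply (x : ThreeBlocks n) :
    blockAdjacency n x = ![x 0 + x 1 + x 2, x 0 + x 1, 0] := rfl

theorem blockAdjacency_schur (hn : 1 ≤ n) (x : ThreeBlocks n) :
    LinearMap.mul' ℂ _ (TensorProduct.map (blockAdjacency n).toLinearMap
      (blockAdjacency n).toLinearMap ((blockTrace hn).comul x))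
    = (3 * n ^ 2 : ℂ) • blockAdjacency n x := by
  rw [FaithfulState.lmul_comul (blockTrace_isTracial hn)
    (blockUnit_frame (l := fun _ => (3 * n)⁻¹) (fun _ => by positivity) (blockTrace_apply hn))]
  -- Both `x e` and `e*` lie in the block of `e`, and on a single block `A` is multiplicative: it
  -- copies the block to distinct targets. The sum then reduces to `∑ 3n · e e* = 3n² · 1`.
  have h1 : ∀ s, (blockAdjacency n).toLinearMap (x * blockUnit s) *
      (blockAdjacency n).toLinearMap (star (blockUnit s)) =
        blockAdjacency n (x * blockUnit s * star (blockUnit s)) := by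
    rintro ⟨a, i, j⟩
    change blockAdjacency n _ * blockAdjacency n _ = _
    rw [blockAdjacency_apply, blockAdjacency_apply, blockAdjacency_apply]
    funext b
    fin_cases b <;> fin_cases a <;> simp [blockUnit]
  simp only [h1, ← map_smul, ← map_sum]
  congr 1
  simp only [Fintype.sum_prod_type, mul_assoc]
  simp only [← Finset.smul_sum, ← Finset.mul_sum, sum_blockUnit_mul, mul_smul_comm,
    mul_blockProj]
  funext a
  fin_cases a <;> simp [Fin.sum_univ_three, smul_smul] <;> rw [mul_assoc, sq]

theorem exists_isThreeBlockGraph (hn : 1 ≤ n) :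
    ∃ G : QuantumGraph (ThreeBlocks n), IsThreeBlockGraph G := by
  refine ⟨⟨blockTrace hn, √(3 * n ^ 2), blockTrace_isDeltaForm hn, blockAdjacency n,
    LinearMap.ext fun x => ?_⟩, blockTrace_isTracial hn, blockAdjacency_apply⟩
  refine (blockAdjacency_schur hn x).trans ?_
  rw [← Complex.ofReal_pow, Real.sq_sqrt (by positivity)]
  push_cast
  rfl

end QuantumGraphs.QuantumGraph

/-! ### Path vectors of the three-block graph and Condition (S) -/

namespace QuantumGraphs

universe u

namespace Correspondence

variable {B : Type u} [CStarAlgebra B] [PartialOrder B] [StarOrderedRing B]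

theorem inner_right_left_self (X : Correspondence B) (p q b : B) (ξ : X.carrier) :
    X.inner (X.right q (X.left p ξ)) (X.left b (X.right q (X.left p ξ)))
      = star q * X.inner ξ (X.left (star p * b * p) ξ) * q := by
  rw [X.left_right, X.inner_right, X.inner_right_left, X.inner_left, ← X.left_mul, ← X.left_mul,
    mul_assoc (star p)]

end Correspondence

namespace QuantumGraph

theorem isNonReturning_pathVector {B : Type u} [CStarAlgebra B] [PartialOrder B]
    [StarOrderedRing B] [FiniteDimensional ℂ B] (G : QuantumGraph B) {p q : B} (hp : p * p = p)
    (hq : star q = q) (hqq : q * q = q) (hqp : ∀ b, q * b * p = 0) (k : ℕ) :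
    G.edgeCorrespondence.IsNonReturning (G.pathVector p q k) := by
  refine Correspondence.isNonReturning_powTensor (p := p) (q := q) ?_ ?_ ?_ hq hqp k
  · rw [Correspondence.left_right, ← Correspondence.left_mul, hp]
  · rw [← Correspondence.right_mul, hqq]
  · rw [← Correspondence.right_mul, hqq]

theorem left_pathVector {B : Type u} [CStarAlgebra B] [PartialOrder B]
    [StarOrderedRing B] [FiniteDimensional ℂ B] (G : QuantumGraph B) {p : B} (hp : p * p = p)
    (q : B) (k : ℕ) :
    (G.edgeCorrespondence.tpow (k + 1)).left p (G.pathVector p q k) = G.pathVector p q k :=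
  Correspondence.left_powTensor
    (by rw [Correspondence.left_right, ← Correspondence.left_mul, hp]) _ k

variable {n : ℕ} {G : QuantumGraph (ThreeBlocks n)}

theorem star_blockProj (a : Fin 3) : star (blockProj a : ThreeBlocks n) = blockProj a := by
  rw [blockProj, ← Pi.single_star, star_one]

theorem blockProj_mul_self (a : Fin 3) :
    (blockProj a * blockProj a : ThreeBlocks n) = blockProj a := by
  rw [mul_blockProj, blockProj, Pi.single_eq_same]

theorem blockProj_mul_mul {a b : Fin 3} (hab : a ≠ b) (x : ThreeBlocks n) :
    blockProj b * x * blockProj a = 0 := by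
  rw [mul_blockProj, blockProj_mul, Pi.single_eq_of_ne hab, Pi.single_zero]

theorem inner_edgeVector_of_isThreeBlockGraph (hn : 1 ≤ n) (hG : IsThreeBlockGraph G)
    (y : ThreeBlocks n) :
    G.edgeCorrespondence.inner G.edgeVector (G.edgeCorrespondence.left y G.edgeVector)
      = ((G.δ : ℂ) ^ 2)⁻¹ • G.A y := by
  refine inner_edgeVector hG.1 (blockUnit_frame (l := fun _ => (3 * n)⁻¹)
    (fun _ => by positivity) (eq_trace_of_isDeltaForm hn hG.1 G.isDeltaForm).2) (fun x => ?_) y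
  change star (G.A x) = G.A (star x)
  rw [hG.2, hG.2]
  funext a
  fin_cases a <;> simp

theorem inner_left_pathVector (hn : 1 ≤ n) (hG : IsThreeBlockGraph G) {a b : Fin 3}
    (hab : ∀ m, G.A (Pi.single a m) b = m) (hbb : ∀ m, G.A (Pi.single b m) b = m) (k : ℕ)
    (x : ThreeBlocks n) :
    (G.edgeCorrespondence.tpow (k + 1)).inner (G.pathVector (blockProj a) (blockProj b) k)
        ((G.edgeCorrespondence.tpow (k + 1)).left x (G.pathVector (blockProj a) (blockProj b) k))
      = (((G.δ : ℂ) ^ 2)⁻¹) ^ (k + 1) • Pi.single b (x a) := by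
  -- The source block is quantified anew, since the claim serves both for the first edge `a → b` and
  -- for the loop `b → b`.
  have h1 : ∀ m : Matrix (Fin n) (Fin n) ℂ, ∀ a, (∀ m, G.A (Pi.single a m) b = m) →
      star (blockProj b) * G.edgeCorrespondence.inner G.edgeVector
        (G.edgeCorrespondence.left (Pi.single a m) G.edgeVector) * blockProj b
        = ((G.δ : ℂ) ^ 2)⁻¹ • Pi.single b m := fun m a ha => by
    rw [inner_edgeVector_of_isThreeBlockGraph hn hG, star_blockProj, mul_blockProj, blockProj_mul,
      Pi.single_eq_same, Pi.smul_apply, ha, Pi.single_smul]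
  rw [pathVector, Correspondence.inner_left_powTensor, Correspondence.inner_right_left_self,
    star_blockProj a, mul_blockProj _ a, blockProj_mul, Pi.single_eq_same, h1 _ a hab]
  -- The later edges need no `1_b` on the left: what reaches them is already supported in block `b`.
  have h2 : ∀ m : Matrix (Fin n) (Fin n) ℂ,
      G.edgeCorrespondence.inner (G.edgeCorrespondence.right (blockProj b) G.edgeVector)
        (G.edgeCorrespondence.left (Pi.single b m)
          (G.edgeCorrespondence.right (blockProj b) G.edgeVector))
        = ((G.δ : ℂ) ^ 2)⁻¹ • Pi.single b m := fun m => by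
    rw [Correspondence.left_right, Correspondence.inner_right, Correspondence.inner_right_left,
      h1 m b hbb]
  induction k with
  | zero => rw [Function.iterate_zero_apply, zero_add, pow_one]
  | succ k ih =>
    rw [Function.iterate_succ_apply', ih]
    simp only [map_smul, LinearMap.smul_apply]
    rw [h2, smul_smul, ← pow_succ]

theorem exists_norm_apply_eq (x : ThreeBlocks n) : ∃ a, ‖x a‖ = ‖x‖ := by
  obtain ⟨a, ha⟩ := Finite.exists_max fun a => ‖x a‖
  exact ⟨a, le_antisymm (norm_le_pi_norm x a) ((pi_norm_le_iff_of_nonneg (norm_nonneg _)).mpr ha)⟩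

/-- Block 0 goes to 1, blocks 1 and 2 go to 0. Block 2 has no loop and is never a target. -/
theorem exists_loop_edge (hG : IsThreeBlockGraph G) (a : Fin 3) : ∃ b, a ≠ b ∧
    (∀ m, G.A (Pi.single a m) b = m) ∧ ∀ m, G.A (Pi.single b m) b = m := by
  simp only [hG.2]
  obtain rfl | ha := eq_or_ne a 0
  · exact ⟨1, by simp⟩
  · exact ⟨0, ha, fun m => by fin_cases a <;> simp_all, by simp⟩

theorem exists_nonReturning_pathVector (hn : 1 ≤ n) (hG : IsThreeBlockGraph G)
    (x : ThreeBlocks n) : ∃ a b : Fin 3, a ≠ b ∧ ∀ k : ℕ,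
      ∃ ξ : (G.edgeCorrespondence.tpow (k + 1)).carrier,
        (∃ c : ℝ, 0 < c ∧ ξ = (c : ℂ) • G.pathVector (blockProj a) (blockProj b) k) ∧
        (G.edgeCorrespondence.tpow (k + 1)).norm ξ = 1 ∧
        G.edgeCorrespondence.IsNonReturning ξ ∧
        ‖(G.edgeCorrespondence.tpow (k + 1)).inner ξ
          ((G.edgeCorrespondence.tpow (k + 1)).left x ξ)‖ = ‖x‖ := by
  obtain ⟨a, ha⟩ := exists_norm_apply_eq x
  obtain ⟨b, hab, hA, hB⟩ := exists_loop_edge hG a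
  refine ⟨a, b, hab, fun k => ?_⟩
  have hδ : (G.δ : ℂ) ≠ 0 := Complex.ofReal_ne_zero.mpr G.isDeltaForm.1.ne'
  -- The `k + 1` edges contribute `δ^(-2(k+1))` to the inner product, in which the scalar appears
  -- squared.
  set ξ := ((G.δ ^ (k + 1) : ℝ) : ℂ) • G.pathVector (blockProj a) (blockProj b) k with hξ
  have hinner : ∀ y : ThreeBlocks n, (G.edgeCorrespondence.tpow (k + 1)).inner ξ
      ((G.edgeCorrespondence.tpow (k + 1)).left y ξ) = Pi.single b (y a) := fun y => by
    simp only [hξ, LinearMap.map_smulₛₗ, LinearMap.smul_apply, RingHom.id_apply,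
      Complex.conj_ofReal]
    rw [inner_left_pathVector hn hG hA hB, smul_smul, smul_smul]
    push_cast
    rw [← mul_pow, ← mul_pow, ← sq, mul_inv_cancel₀ (pow_ne_zero 2 hδ), one_pow,
      one_smul]
  refine ⟨ξ, ⟨_, pow_pos G.isDeltaForm.1 _, rfl⟩, ?_, ?_, ?_⟩
  -- As `1_a · ξ = ξ`, the formula at `y = 1_a` gives `⟨ξ | ξ⟩ = 1_b`, which has norm `1` because `n
  -- ≥ 1`.
  · have hp : (G.edgeCorrespondence.tpow (k + 1)).left (blockProj a) ξ = ξ := by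
      rw [hξ, map_smul, left_pathVector G (blockProj_mul_self a)]
    have : Nonempty (Fin n) := ⟨⟨0, hn⟩⟩
    have h1 := hinner (blockProj a)
    rw [hp, blockProj, Pi.single_eq_same] at h1
    rw [Correspondence.norm, h1, Pi.norm_single, norm_one, Real.sqrt_one]
  · exact (isNonReturning_pathVector G (blockProj_mul_self a) (star_blockProj b)
      (blockProj_mul_self b) (blockProj_mul_mul hab) k).smul _
  · rw [hinner, Pi.norm_single, ha]

theorem conditionS_of_isThreeBlockGraph (hn : 1 ≤ n) (hG : IsThreeBlockGraph G) :
    G.edgeCorrespondence.ConditionS := fun x _ k ε hε => by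
  obtain ⟨a, b, -, h⟩ := exists_nonReturning_pathVector hn hG x
  -- The path of index `k` has `k + 1 > k` edges and attains `‖x‖` exactly, so any `ε > 0` will do.
  obtain ⟨ξ, -, hξ, hnr, hx⟩ := h k
  exact ⟨k + 1, k.lt_succ_self, ξ, hξ, hnr, by rw [hx]; linarith⟩

end QuantumGraph

end QuantumGraphs

theorem mainTheorem6 (n : ℕ) (hn : 1 ≤ n) :
    (∃! ψ : FaithfulState (ThreeBlocks n), ψ.IsTracial ∧ ∃ δ : ℝ, ψ.IsDeltaForm δ) ∧
    (∃ G : QuantumGraph (ThreeBlocks n), IsThreeBlockGraph G) ∧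
    ∀ G : QuantumGraph (ThreeBlocks n), IsThreeBlockGraph G →
      G.edgeCorrespondence.ConditionS ∧
      ∀ x : ThreeBlocks n, ∃ a b : Fin 3, a ≠ b ∧ ∀ k : ℕ,
        ∃ ξ : (G.edgeCorrespondence.tpow (k + 1)).carrier,
          (∃ c : ℝ, 0 < c ∧ ξ = (c : ℂ) • G.pathVector (blockProj a) (blockProj b) k) ∧
          (G.edgeCorrespondence.tpow (k + 1)).norm ξ = 1 ∧
          G.edgeCorrespondence.IsNonReturning ξ ∧
          ‖(G.edgeCorrespondence.tpow (k + 1)).inner ξ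
            ((G.edgeCorrespondence.tpow (k + 1)).left x ξ)‖ = ‖x‖ :=
  ⟨QuantumGraph.existsUnique_tracial_deltaForm hn, QuantumGraph.exists_isThreeBlockGraph hn,
    fun _ hG => ⟨QuantumGraph.conditionS_of_isThreeBlockGraph hn hG,
      QuantumGraph.exists_nonReturning_pathVector hn hG⟩⟩
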